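/- Let $d\ge 2$, let $\mathcal H_1,\dots,\mathcal H_d$ be separable real Hilbert spaces (of finite or infinite dimension), and let $\mathcal H=\mathcal H_1\otimes\cdots\otimes\mathcal H_d$ be their Hilbert space tensor product, with its canonical norm $\|\cdot\|$. For $n\subseteq\{1,\dots,d\}$ write $[n]=\{1,\dots,d\}\setminus n$. Let $\mathbb T$ be a binary dimension tree with root $\{1,\dots,d\}$: its nodes are subsets of $\{1,\dots,d\}$, its leaves are singletons, and every other node is the disjoint union of its two sons. Let $\mathbb E=\{\{n,[n]\} : n\in\mathbb T\setminus\{\{1,\dots,d\}\}\}$ be its set of edges, which has $E=2d-3$ elements, and fix any enumeration $\{n_t,[n_t]\}$, $t=1,\dots,E$, of $\mathbb E$. For $\mathbf u\in\mathcal H$ let the matricization $\mathcal M_t(\mathbf u):\bigotimes_{i\in[n_t]}\mathcal H_i\to\bigotimes_{i\in n_t}\mathcal H_i$ be the Hilbert–Schmidt operator with $\langle \mathcal M_t(\mathbf u)\,b,a\rangle=\langle \mathbf u,a\otimes b\rangle$ for all $a\in\bigotimes_{i\in n_t}\mathcal H_i$, $b\in\bigotimes_{i\in[n_t]}\mathcal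 H_i$, and let $\mathcal M_t^{-1}$ be the inverse map, from Hilbert–Schmidt operators to $\mathcal H$. For $\alpha>0$ and $x\in\mathbb R$ let $s_\alpha(x)=\operatorname{sgn}(x)\max\{|x|-\alpha,0\}$. For a Hilbert–Schmidt operator $X$ with singular value decomposition $X=\sum_{k}\sigma_k\langle\cdot,v_k\rangle u_k$ let $S_\alpha(X)=\sum_k s_\alpha(\sigma_k)\langle\cdot,v_k\rangle u_k$. Put $S_{t,\alpha}=\mathcal M_t^{-1}\circ S_\alpha\circ\mathcal M_t$ and $$\mathbf S_\alpha = S_{E,\alpha}\circ\cdots\circ S_{1,\alpha}:\mathcal H\to\mathcal H.$$ Then for all $\mathbf u,\mathbf v\in\mathcal H$ and all $\alpha>0$, $$\|\mathbf S_\alpha(\mathbf u)-\mathbf S_\alpha(\mathbf v)\|\le\|\mathbf u-\mathbf v\|.$$ -/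

import Mathlib

open scoped TensorProduct

noncomputable section

namespace HTensor

universe w₀ w₁

/-! ### The Hilbert tensor product of a finite family of real Hilbert spaces

The algebraic tensor product `⨂ i, H i` carries the (semi-)inner product determined by
`⟪⨂ xᵢ, ⨂ yᵢ⟫ = ∏ ⟪xᵢ, yᵢ⟫`; the Hilbert tensor product is its completion. -/

section Tensor

variable {ι : Type w₀} (H : ι → Type w₁) [∀ i, NormedAddCommGroup (H i)]
  [∀ i, InnerProductSpace ℝ (H i)]

/-- The algebraic tensor product `⨂ i, H i`, as a type of its own, so that it can carry the
norm coming from the inner product (and no other norm). -/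
def AlgTensor : Type (max w₀ w₁) := PiTensorProduct ℝ H

instance : AddCommGroup (AlgTensor H) := inferInstanceAs (AddCommGroup (PiTensorProduct ℝ H))

instance : Module ℝ (AlgTensor H) := inferInstanceAs (Module ℝ (PiTensorProduct ℝ H))

variable {H}

/-- The elementary tensor `⨂ i, x i` in the algebraic tensor product. -/
def algPure (x : ∀ i, H i) : AlgTensor H := PiTensorProduct.tprod ℝ x

theorem AlgTensor.induction {p : AlgTensor H → Prop}
    (smul : ∀ (c : ℝ) (x : ∀ i, H i), p (c • algPure x))
    (add : ∀ a b, p a → p b → p (a + b)) (a : AlgTensor H) : p a :=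
  PiTensorProduct.induction_on (motive := p) a smul add

variable (H) in
/-- The bilinear form on `⨂ i, H i` with `⟪⨂ xᵢ, ⨂ yᵢ⟫ = ∏ ⟪xᵢ, yᵢ⟫`. -/
def algForm [Fintype ι] : AlgTensor H →ₗ[ℝ] AlgTensor H →ₗ[ℝ] ℝ :=
  (PiTensorProduct.dualDistrib (R := ℝ) (M := H)).comp
    (PiTensorProduct.map (fun i => innerₗ (H i)))

theorem posSemidef_prod_gram {κ : Type*} [Finite κ] (x : κ → ∀ i, H i) (s : Finset ι) :
    (Matrix.of fun k l => ∏ i ∈ s, inner ℝ (x k i) (x l i) : Matrix κ κ ℝ).PosSemidef := by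
  classical
  induction s using Finset.induction_on with
  | empty =>
    have h : (Matrix.of fun k l => ∏ i ∈ (∅ : Finset ι), inner ℝ (x k i) (x l i) :
        Matrix κ κ ℝ) = Matrix.gram ℝ (fun _ : κ => (1 : ℝ)) := by
      ext k l
      simp [Matrix.gram_apply]
    rw [h]
    exact Matrix.posSemidef_gram ℝ _
  | insert j s hj ih =>
    have h : (Matrix.of fun k l => ∏ i ∈ insert j s, inner ℝ (x k i) (x l i) : Matrix κ κ ℝ) =
        Matrix.hadamard (Matrix.gram ℝ (fun k : κ => x k j))
          (Matrix.of fun k l => ∏ i ∈ s, inner ℝ (x k i) (x l i)) := by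
      ext k l
      simp [Matrix.gram_apply, Finset.prod_insert hj]
    rw [h]
    exact (Matrix.posSemidef_gram ℝ _).hadamard ih

variable [Fintype ι]

theorem algForm_pure (x y : ∀ i, H i) :
    algForm H (algPure x) (algPure y) = ∏ i, inner ℝ (x i) (y i) := by
  change PiTensorProduct.dualDistrib (R := ℝ) (M := H)
    (PiTensorProduct.map (fun i => innerₗ (H i)) (PiTensorProduct.tprod ℝ x))
    (PiTensorProduct.tprod ℝ y) = _
  rw [PiTensorProduct.map_tprod, PiTensorProduct.dualDistrib_apply]
  rfl

theorem algForm_symm (a b : AlgTensor H) : algForm H a b = algForm H b a := by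
  induction a using AlgTensor.induction with
  | smul c x =>
    induction b using AlgTensor.induction with
    | smul c' y =>
      simp only [map_smul, LinearMap.smul_apply, algForm_pure, smul_eq_mul]
      simp only [real_inner_comm]
      ring
    | add b b' hb hb' => simp only [map_add, LinearMap.add_apply, hb, hb']
  | add a a' ha ha' => simp only [map_add, LinearMap.add_apply, ha, ha']

theorem algForm_self_nonneg (a : AlgTensor H) : 0 ≤ algForm H a a := by
  classical
  have ha : a ∈ Submodule.span ℝ (Set.range (algPure : (∀ i, H i) → AlgTensor H)) := by
    have h : Submodule.span ℝ (Set.range (algPure : (∀ i, H i) → AlgTensor H)) = ⊤ :=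
      PiTensorProduct.span_tprod_eq_top
    rw [h]
    trivial
  obtain ⟨c, rfl⟩ := Finsupp.mem_span_range_iff_exists_finsupp.1 ha
  have h := (posSemidef_prod_gram (fun x : c.support => x.1) Finset.univ).dotProduct_mulVec_nonneg
    (fun k => c k)
  refine h.trans_eq ?_
  simp only [Finsupp.sum, map_sum, map_smul, LinearMap.sum_apply, LinearMap.smul_apply,
    algForm_pure, smul_eq_mul, Matrix.of_apply, Finset.mul_sum, dotProduct, Matrix.mulVec,
    Pi.star_apply, star_trivial]
  rw [← Finset.sum_coe_sort c.support]
  refine Finset.sum_congr rfl fun k _ => ?_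
  rw [← Finset.sum_coe_sort c.support]
  refine Finset.sum_congr rfl fun l _ => ?_
  simp only [real_inner_comm]
  ring

variable (H) in
/-- The semi-inner product on the algebraic tensor product. -/
@[reducible]
def algCore : PreInnerProductSpace.Core ℝ (AlgTensor H) where
  inner a b := algForm H a b
  conj_inner_symm a b := by
    rw [conj_trivial]
    exact algForm_symm b a
  re_inner_nonneg a := algForm_self_nonneg a
  add_left a b c := by simp
  smul_left a b r := by simp

instance : SeminormedAddCommGroup (AlgTensor H) :=
  @InnerProductSpace.Core.toSeminormedAddCommGroup ℝ _ _ _ _ (algCore H)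

instance : InnerProductSpace ℝ (AlgTensor H) :=
  InnerProductSpace.ofCore (algCore H)

theorem inner_algPure (x y : ∀ i, H i) :
    inner ℝ (algPure x) (algPure y) = ∏ i, inner ℝ (x i) (y i) :=
  algForm_pure x y

variable (H) in
/-- The Hilbert tensor product of the family `H`. -/
abbrev HilbertTensor : Type (max w₀ w₁) := UniformSpace.Completion (AlgTensor H)

/-- The elementary tensor `⨂ i, x i` in the Hilbert tensor product. -/
def pure (x : ∀ i, H i) : HilbertTensor H := (algPure x : UniformSpace.Completion (AlgTensor H))

theorem inner_pure (x y : ∀ i, H i) :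
    inner ℝ (pure x) (pure y) = ∏ i, inner ℝ (x i) (y i) := by
  simp only [pure, UniformSpace.Completion.inner_coe, inner_algPure]

end Tensor

/-! ### Splitting the index set

For `n ⊆ ι` there is a canonical identification
`(⨂ i ∈ n, H i) ⊗ (⨂ i ∉ n, H i) ≃ ⨂ i, H i`. -/

section Split

variable {ι : Type w₀} [DecidableEq ι] (H : ι → Type w₁)
  [∀ i, NormedAddCommGroup (H i)] [∀ i, InnerProductSpace ℝ (H i)] (n : Finset ι)

/-- The family `H` restricted to the indices in `n`. -/
abbrev InFam : {i // i ∈ n} → Type w₁ := fun i => H i.1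

/-- The family `H` restricted to the indices not in `n`. -/
abbrev OutFam : {i // i ∉ n} → Type w₁ := fun i => H i.1

variable {H n} in
/-- Two families of vectors, indexed by `n` and by its complement, as one family. -/
def mergeFam (x : ∀ i, InFam H n i) (y : ∀ i, OutFam H n i) (i : ι) : H i :=
  if h : i ∈ n then x ⟨i, h⟩ else y ⟨i, h⟩

/-- The bilinear map `(⨂ i ∈ n, H i) × (⨂ i ∉ n, H i) → ⨂ i, H i`. -/
def algMerge : AlgTensor (InFam H n) →ₗ[ℝ] AlgTensor (OutFam H n) →ₗ[ℝ] AlgTensor H :=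
  (TensorProduct.mk ℝ (PiTensorProduct ℝ (InFam H n)) (PiTensorProduct ℝ (OutFam H n))).compr₂
    ((PiTensorProduct.tmulEquivDep ℝ (fun j => H (Equiv.sumCompl (· ∈ n) j))).trans
      (PiTensorProduct.reindex ℝ H (Equiv.sumCompl (· ∈ n)).symm).symm).toLinearMap

variable {H n}

theorem algMerge_pure (x : ∀ i, InFam H n i) (y : ∀ i, OutFam H n i) :
    algMerge H n (algPure x) (algPure y) = algPure (mergeFam x y) := by
  change (PiTensorProduct.reindex ℝ H (Equiv.sumCompl (· ∈ n)).symm).symm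
    (PiTensorProduct.tmulEquivDep ℝ (fun j => H (Equiv.sumCompl (· ∈ n) j))
      (PiTensorProduct.tprod ℝ x ⊗ₜ[ℝ] PiTensorProduct.tprod ℝ y)) =
    PiTensorProduct.tprod ℝ (mergeFam x y)
  rw [LinearEquiv.symm_apply_eq, PiTensorProduct.reindex_tprod]
  erw [PiTensorProduct.tmulEquivDep_apply]
  congr 1
  ext j
  rcases j with ⟨i, hi⟩ | ⟨i, hi⟩ <;> simp [mergeFam, hi]

variable [Fintype ι]

theorem inner_algMerge (a a' : AlgTensor (InFam H n)) (b b' : AlgTensor (OutFam H n)) :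
    inner ℝ (algMerge H n a b) (algMerge H n a' b') = inner ℝ a a' * inner ℝ b b' := by
  induction a using AlgTensor.induction with
  | add a₁ a₂ h₁ h₂ => simp only [map_add, LinearMap.add_apply, inner_add_left, h₁, h₂, add_mul]
  | smul c x =>
  induction a' using AlgTensor.induction with
  | add a₁ a₂ h₁ h₂ => simp only [map_add, LinearMap.add_apply, inner_add_right, h₁, h₂, add_mul]
  | smul c' x' =>
  induction b using AlgTensor.induction with
  | add a₁ a₂ h₁ h₂ => simp only [map_add, inner_add_left, h₁, h₂, mul_add]
  | smul e y =>
  induction b' using AlgTensor.induction with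
  | add a₁ a₂ h₁ h₂ => simp only [map_add, inner_add_right, h₁, h₂, mul_add]
  | smul e' y' =>
  have key : ∏ i, inner ℝ (mergeFam x y i) (mergeFam x' y' i) =
      (∏ i, inner ℝ (x i) (x' i)) * ∏ i, inner ℝ (y i) (y' i) := by
    rw [← (Equiv.sumCompl (· ∈ n)).prod_comp, Fintype.prod_sum_type]
    congr 1 <;> refine Finset.prod_congr rfl fun i _ => ?_ <;>
      simp [mergeFam, i.2] <;> rfl
  simp only [map_smul, LinearMap.smul_apply, inner_smul_left, inner_smul_right, algMerge_pure,
    inner_algPure, key, conj_trivial]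
  ring

theorem norm_algMerge (a : AlgTensor (InFam H n)) (b : AlgTensor (OutFam H n)) :
    ‖algMerge H n a b‖ = ‖a‖ * ‖b‖ := by
  have h : ‖algMerge H n a b‖ ^ 2 = (‖a‖ * ‖b‖) ^ 2 := by
    rw [mul_pow, ← real_inner_self_eq_norm_sq, ← real_inner_self_eq_norm_sq,
      ← real_inner_self_eq_norm_sq, inner_algMerge]
  exact (pow_left_inj₀ (norm_nonneg _) (by positivity) two_ne_zero).1 h

variable (H n) in
/-- The bilinear map `(a, b) ↦ a ⊗ b`, with values in the Hilbert tensor product, as a bounded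
bilinear map on the algebraic tensor products. -/
def preMerge : AlgTensor (InFam H n) →L[ℝ] AlgTensor (OutFam H n) →L[ℝ] HilbertTensor H :=
  LinearMap.mkContinuous₂
    ((algMerge H n).compr₂
      (UniformSpace.Completion.toComplL (𝕜 := ℝ) (E := AlgTensor H)).toLinearMap) 1
    (fun a b => by
      have h := norm_algMerge a b
      simp [h])

variable (H n) in
/-- The bounded bilinear map `(a, b) ↦ a ⊗ b` from
`(⨂ i ∈ n, H i) × (⨂ i ∉ n, H i)` to `⨂ i, H i` (Hilbert tensor products), obtained by
continuous extension in both variables. -/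
def merge : HilbertTensor (InFam H n) →L[ℝ] HilbertTensor (OutFam H n) →L[ℝ] HilbertTensor H :=
  (((preMerge H n).extend UniformSpace.Completion.toComplL).flip.extend
    UniformSpace.Completion.toComplL).flip

theorem merge_coe (a : AlgTensor (InFam H n)) (b : AlgTensor (OutFam H n)) :
    merge H n (a : HilbertTensor (InFam H n)) (b : HilbertTensor (OutFam H n)) =
      (algMerge H n a b : HilbertTensor H) := by
  have h₁ := ContinuousLinearMap.extend_eq (preMerge H n)
    (e := UniformSpace.Completion.toComplL (𝕜 := ℝ) (E := AlgTensor (InFam H n)))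
    UniformSpace.Completion.denseRange_coe
    (UniformSpace.Completion.isUniformInducing_coe _) a
  have h₂ := ContinuousLinearMap.extend_eq
    ((preMerge H n).extend UniformSpace.Completion.toComplL).flip
    (e := UniformSpace.Completion.toComplL (𝕜 := ℝ) (E := AlgTensor (OutFam H n)))
    UniformSpace.Completion.denseRange_coe
    (UniformSpace.Completion.isUniformInducing_coe _) b
  have h₃ := congrArg (fun f => f (a : HilbertTensor (InFam H n))) h₂
  refine h₃.trans ?_
  exact congrArg (fun f => f b) h₁

theorem merge_pure (x : ∀ i, InFam H n i) (y : ∀ i, OutFam H n i) :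
    merge H n (pure x) (pure y) = pure (mergeFam x y) := by
  simp only [pure, merge_coe, algMerge_pure]

variable (n) in
/-- The matricization of the tensor `u` with respect to the splitting `{n, nᶜ}`: the operator
`⨂ i ∉ n, H i → ⨂ i ∈ n, H i` determined by `⟪M u b, a⟫ = ⟪u, a ⊗ b⟫` (it is always a
Hilbert-Schmidt operator). -/
def matricization (u : HilbertTensor H) :
    HilbertTensor (OutFam H n) →L[ℝ] HilbertTensor (InFam H n) :=
  LinearMap.mkContinuous
    { toFun := fun b => ContinuousLinearMap.adjoint ((merge H n).flip b) u
      map_add' := fun b b' => by simp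
      map_smul' := fun c b => by simp }
    (‖(merge H n).flip‖ * ‖u‖)
    (fun b => by
      refine (ContinuousLinearMap.le_opNorm
        (ContinuousLinearMap.adjoint ((merge H n).flip b)) u).trans ?_
      rw [LinearIsometryEquiv.norm_map, mul_right_comm]
      gcongr
      exact ContinuousLinearMap.le_opNorm (merge H n).flip b)

theorem inner_matricization (u : HilbertTensor H) (a : HilbertTensor (InFam H n))
    (b : HilbertTensor (OutFam H n)) :
    inner ℝ (matricization n u b) a = inner ℝ u (merge H n a b) :=
  ContinuousLinearMap.adjoint_inner_left ((merge H n).flip b) a u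

theorem matricization_injective :
    Function.Injective (matricization n : HilbertTensor H → _) := by
  intro u u' h
  refine ext_inner_right ℝ fun w => ?_
  induction w using UniformSpace.Completion.induction_on with
  | hp => exact isClosed_eq (by fun_prop) (by fun_prop)
  | ih a =>
    induction a using AlgTensor.induction with
    | smul c z =>
      have hz := congrArg (fun A => inner ℝ (A (pure fun i : {i // i ∉ n} => z i.1))
        (pure fun i : {i // i ∈ n} => z i.1)) h
      have hm : mergeFam (H := H) (n := n) (fun i => z i.1) (fun i => z i.1) = z := by
        ext i
        simp [mergeFam]
      simp only [inner_matricization, merge_pure, hm] at hz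
      simp only [UniformSpace.Completion.coe_smul, inner_smul_right]
      exact congrArg (c * ·) hz
    | add a b ha hb => simp only [UniformSpace.Completion.coe_add, inner_add_right, ha, hb]

variable (H n) in
/-- The map that converts a matricization back to a tensor: the inverse of the (injective)
map `u ↦ matricization n u` on its range. -/
def tensorization (A : HilbertTensor (OutFam H n) →L[ℝ] HilbertTensor (InFam H n)) :
    HilbertTensor H :=
  Function.invFun (matricization (H := H) n) A

end Split

/-! ### Soft thresholding -/

/-- Soft thresholding of a real number: `sgn x * max (|x| - α) 0`. -/
def softThreshold (α x : ℝ) : ℝ := Real.sign x * max (|x| - α) 0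

section SVD

variable {S₁ S₂ : Type*} [NormedAddCommGroup S₁] [InnerProductSpace ℝ S₁]
  [NormedAddCommGroup S₂] [InnerProductSpace ℝ S₂]

/-- A singular value decomposition `X = ∑ₖ σₖ ⟪·, vₖ⟫ uₖ` of an operator: the singular values are
nonnegative, nonincreasing and extended by zero to a sequence on `ℕ`, and the singular vectors
belonging to nonzero singular values are orthonormal. -/
structure SVD (X : S₁ →L[ℝ] S₂) where
  σ : ℕ → ℝ
  u : ℕ → S₂
  v : ℕ → S₁
  nonneg : ∀ k, 0 ≤ σ k
  antitone : Antitone σ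
  orthonormal_u : Orthonormal ℝ (fun k : Function.support σ => u k)
  orthonormal_v : Orthonormal ℝ (fun k : Function.support σ => v k)
  hasSum : HasSum (fun k => σ k • InnerProductSpace.rankOne ℝ (u k) (v k)) X

/-- Soft thresholding of the singular values of an operator:
`∑ₖ s_α(σₖ) ⟪·, vₖ⟫ uₖ` for a singular value decomposition `X = ∑ₖ σₖ ⟪·, vₖ⟫ uₖ`
(the result does not depend on the decomposition). Every compact operator, in particular every
Hilbert-Schmidt operator, between Hilbert spaces has such a decomposition; the value at an
operator without one is irrelevant. -/
def softThresholdOp (α : ℝ) (X : S₁ →L[ℝ] S₂) : S₁ →L[ℝ] S₂ :=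
  open Classical in
  if h : Nonempty (SVD X) then
    ∑' k, softThreshold α (h.some.σ k) • InnerProductSpace.rankOne ℝ (h.some.u k) (h.some.v k)
  else 0

end SVD

/-! ### Dimension trees and their edges -/

section Tree

variable {ι : Type*} [DecidableEq ι]

/-- `IsDimTree r T`: `T` is the set of nodes of a binary dimension tree with root `r`, that is,
a binary tree whose leaves are singletons and in which every other node is the disjoint union
of its two sons. -/
inductive IsDimTree : Finset ι → Finset (Finset ι) → Prop
  | leaf (i : ι) : IsDimTree {i} {{i}}
  | node {r₁ r₂ : Finset ι} {T₁ T₂ : Finset (Finset ι)} (h₁ : IsDimTree r₁ T₁)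
      (h₂ : IsDimTree r₂ T₂) (hr : Disjoint r₁ r₂) :
      IsDimTree (r₁ ∪ r₂) (insert (r₁ ∪ r₂) (T₁ ∪ T₂))

variable [Fintype ι]

/-- The set of edges `{ {n, [n]} : n ∈ T, n ≠ root }`, where `[n]` is the complement of `n`. -/
def edges (T : Finset (Finset ι)) : Finset (Finset (Finset ι)) :=
  (T.erase Finset.univ).image fun n => {n, nᶜ}

/-- `n` enumerates the edges of `T` as `{n t, [n t]}`, each edge exactly once. -/
def IsEdgeEnumeration {E : ℕ} (T : Finset (Finset ι)) (n : Fin E → Finset ι) : Prop :=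
  Set.BijOn (fun t => ({n t, (n t)ᶜ} : Finset (Finset ι))) Set.univ (edges T)

end Tree

/-! ### The hierarchical soft thresholding operator -/

section Hierarchical

variable {ι : Type w₀} [Fintype ι] [DecidableEq ι] {H : ι → Type w₁}
  [∀ i, NormedAddCommGroup (H i)] [∀ i, InnerProductSpace ℝ (H i)]

/-- Soft thresholding applied to the matricization with respect to `{n, nᶜ}`. -/
def matSoftThreshold (n : Finset ι) (α : ℝ) (u : HilbertTensor H) : HilbertTensor H :=
  tensorization H n (softThresholdOp α (matricization n u))

/-- The hierarchical soft thresholding operator `S_{E,α} ∘ ⋯ ∘ S_{1,α}` for the splittings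
`{n t, (n t)ᶜ}`, `t = 1, …, E`; the first splitting is used first. -/
def hierSoftThreshold {E : ℕ} (n : Fin E → Finset ι) (α : ℝ) (u : HilbertTensor H) :
    HilbertTensor H :=
  Fin.foldl E (fun w t => matSoftThreshold (n t) α w) u

end Hierarchical

end HTensor

end

noncomputable section

namespace HTensor

open Filter Topology InnerProductSpace

/-! ### Singular value decomposition of compact operators -/

section SingularValues

variable {S₁ S₂ : Type*} [NormedAddCommGroup S₁] [InnerProductSpace ℝ S₁]
  [NormedAddCommGroup S₂] [InnerProductSpace ℝ S₂]

/-! Thresholding one matricization is the proximal map of `α` times its nuclear norm, and proximal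
maps are firmly nonexpansive; a composition of nonexpansive maps is nonexpansive.

For a single splitting let `p`, `q` be the thresholded tensors of `u`, `v`. By
`exists_matSoftThreshold_eq_sum`, `u - p` has matricization of operator norm at most `α`, while `⟪v
- q, q⟫` is `α` times the sum of the singular values of `q`. Duality of the two norms gives `⟪u - p,
q⟫ ≤ ⟪v - q, q⟫`. Adding the same inequality with the roles exchanged yields `‖p - q‖² ≤ ⟪u - v, p -
q⟫`, and Cauchy-Schwarz finishes (`norm_matSoftThreshold_sub_le`). The nuclear norm is never
defined: the finite sums `∑ s k` stand in for it.

The analytic input is that matricizations are compact (`isCompactOperator_matricization`) and hence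
have a singular value decomposition (`nonempty_svd_of_isCompactOperator`), so the thresholding never
falls into its default value. -/

theorem norm_sum_rankOne_le {κ : Type*} {u : κ → S₂} {v : κ → S₁} (hu : Orthonormal ℝ u)
    (hv : Orthonormal ℝ v) {c : κ → ℝ} {C : ℝ} (hC : 0 ≤ C) (F : Finset κ)
    (hc : ∀ k ∈ F, |c k| ≤ C) :
    ‖∑ k ∈ F, c k • rankOne ℝ (u k) (v k)‖ ≤ C := by
  refine ContinuousLinearMap.opNorm_le_bound _ hC fun x => ?_
  have hx : (∑ k ∈ F, c k • rankOne ℝ (u k) (v k)) x =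
      ∑ k ∈ F, (c k * inner ℝ (v k) x) • u k := by
    simp [smul_smul]
  have hsq : ‖∑ k ∈ F, (c k * inner ℝ (v k) x) • u k‖ ^ 2 ≤ (C * ‖x‖) ^ 2 := by
    rw [← real_inner_self_eq_norm_sq, hu.inner_sum, mul_pow]
    -- Bessel's inequality for `v`.
    refine le_trans ?_ (mul_le_mul_of_nonneg_left (hv.sum_inner_products_le x (s := F))
      (sq_nonneg C))
    rw [Finset.mul_sum]
    refine Finset.sum_le_sum fun k hk => ?_
    have h1 : (c k) ^ 2 ≤ C ^ 2 := sq_le_sq' (neg_le_of_abs_le (hc k hk)) (le_of_abs_le (hc k hk))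
    rw [conj_trivial, Real.norm_eq_abs, sq_abs]
    nlinarith [mul_le_mul_of_nonneg_right h1 (sq_nonneg (inner ℝ (v k) x))]
  rw [hx]
  exact (sq_le_sq₀ (norm_nonneg _) (by positivity)).1 hsq

/-- An `SVD` constrains its vectors only where the singular value is nonzero; elsewhere the
coefficients vanish, so those terms drop out. -/
theorem norm_sum_rankOne_le_of_orthonormal_on {κ : Type*} {s : Set κ} {u : κ → S₂} {v : κ → S₁}
    (hu : Orthonormal ℝ fun k : s => u k) (hv : Orthonormal ℝ fun k : s => v k)
    {c : κ → ℝ} (hs : ∀ k ∉ s, c k = 0) {C : ℝ} (hC : 0 ≤ C) (F : Finset κ)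
    (hc : ∀ k ∈ F, |c k| ≤ C) :
    ‖∑ k ∈ F, c k • rankOne ℝ (u k) (v k)‖ ≤ C := by
  classical
  have h := norm_sum_rankOne_le hu hv (c := fun k : s => c k) hC (F.subtype (· ∈ s))
    (fun k hk => hc k (Finset.mem_subtype.1 hk))
  rwa [Finset.sum_subtype_eq_sum_filter (fun k => c k • rankOne ℝ (u k) (v k)),
    Finset.sum_filter_of_ne] at h
  intro k _ hk
  by_contra hks
  exact hk (by rw [hs k hks, zero_smul])

theorem isCompactOperator_rankOne (x : S₂) (y : S₁) :
    IsCompactOperator (rankOne ℝ x y : S₁ →L[ℝ] S₂) := by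
  rw [rankOne_def']
  have h : IsCompactOperator (innerSL ℝ y : S₁ →L[ℝ] ℝ) :=
    isCompactOperator_of_locallyCompactSpace_dom _
  exact h.clm_comp (.toSpanSingleton ℝ x)

variable [CompleteSpace S₁] [CompleteSpace S₂]

/-- Almost-maximizers of `‖X x‖` are almost-eigenvectors of `X* X` for `‖X‖ ^ 2`: expand the square
and bound `‖X* X x‖` by `‖X‖ ^ 2`. -/
theorem norm_sq_adjoint_apply_sub_le (X : S₁ →L[ℝ] S₂) {x : S₁} (hx : ‖x‖ ≤ 1) :
    ‖X.adjoint (X x) - ‖X‖ ^ 2 • x‖ ^ 2 ≤ 2 * ‖X‖ ^ 2 * (‖X‖ ^ 2 - ‖X x‖ ^ 2) := by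
  have h1 : ‖X.adjoint (X x)‖ ≤ ‖X‖ * ‖X x‖ := by
    simpa using X.adjoint.le_opNorm (X x)
  have h2 : ‖X x‖ ≤ ‖X‖ := X.unit_le_opNorm x hx
  have h3 : ‖X.adjoint (X x)‖ ^ 2 ≤ (‖X‖ ^ 2) ^ 2 := by
    have : ‖X.adjoint (X x)‖ ≤ ‖X‖ ^ 2 := by nlinarith [norm_nonneg X]
    gcongr
  have h4 : ‖x‖ ^ 2 ≤ 1 := pow_le_one₀ (norm_nonneg x) hx
  rw [norm_sub_sq_real, inner_smul_right, ContinuousLinearMap.adjoint_inner_left,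
    real_inner_self_eq_norm_sq, norm_smul, mul_pow, Real.norm_of_nonneg (sq_nonneg ‖X‖)]
  nlinarith [mul_le_mul_of_nonneg_left h4 (sq_nonneg (‖X‖ ^ 2))]

theorem exists_norm_apply_eq_opNorm {X : S₁ →L[ℝ] S₂} (hX : IsCompactOperator X) (h0 : X ≠ 0) :
    ∃ v, ‖v‖ = 1 ∧ ‖X v‖ = ‖X‖ := by
  have hpos : 0 < ‖X‖ := norm_pos_iff.2 h0
  have hx : ∀ k : ℕ, ∃ x, ‖x‖ < 1 ∧ ‖X‖ - 1 / ((k : ℝ) + 1) < ‖X x‖ := fun k =>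
    X.exists_lt_apply_of_lt_opNorm (by
      have : (0 : ℝ) < 1 / ((k : ℝ) + 1) := by positivity
      linarith)
  choose x hx1 hx2 using hx
  have hlim : Tendsto (fun k => ‖X (x k)‖) atTop (𝓝 ‖X‖) := by
    refine tendsto_of_tendsto_of_tendsto_of_le_of_le ?_ tendsto_const_nhds
      (fun k => (hx2 k).le) (fun k => X.unit_le_opNorm _ (hx1 k).le)
    simpa using tendsto_const_nhds.sub (tendsto_one_div_add_atTop_nhds_zero_nat (𝕜 := ℝ))
  have hdiff : Tendsto (fun k => X.adjoint (X (x k)) - ‖X‖ ^ 2 • x k) atTop (𝓝 0) := by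
    have hb : Tendsto (fun k => 2 * ‖X‖ ^ 2 * (‖X‖ ^ 2 - ‖X (x k)‖ ^ 2)) atTop (𝓝 0) := by
      have h : Tendsto (fun k => 2 * ‖X‖ ^ 2 * (‖X‖ ^ 2 - ‖X (x k)‖ ^ 2)) atTop
          (𝓝 (2 * ‖X‖ ^ 2 * (‖X‖ ^ 2 - ‖X‖ ^ 2))) :=
        (tendsto_const_nhds.sub (hlim.pow 2)).const_mul _
      rwa [sub_self, mul_zero] at h
    have hsq := squeeze_zero (fun k => sq_nonneg _)
      (fun k => norm_sq_adjoint_apply_sub_le X (hx1 k).le) hb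
    rw [tendsto_zero_iff_norm_tendsto_zero]
    simpa using hsq.sqrt
  obtain ⟨K, hK, hKX⟩ := hX.image_closedBall_subset_compact (f := X.toLinearMap) 1
  obtain ⟨y, -, φ, hφ, hy⟩ := hK.tendsto_subseq (x := fun k => X (x k)) fun k =>
    hKX ⟨x k, by simpa using (hx1 k).le, rfl⟩
  -- Compactness only makes `X (x (φ k))` converge; the approximate eigenvector equation `hdiff`
  -- transfers this to `x (φ k)` itself.
  have hxlim : Tendsto (fun k => x (φ k)) atTop (𝓝 ((‖X‖ ^ 2)⁻¹ • X.adjoint y)) := by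
    have h1 := (((X.adjoint.continuous.tendsto y).comp hy).sub
      (hdiff.comp hφ.tendsto_atTop)).const_smul (‖X‖ ^ 2)⁻¹
    simpa [Function.comp_def, smul_smul, hpos.ne'] using h1
  set v := (‖X‖ ^ 2)⁻¹ • X.adjoint y
  have hXv : ‖X v‖ = ‖X‖ := tendsto_nhds_unique
    ((X.continuous.tendsto v).comp hxlim).norm (hlim.comp hφ.tendsto_atTop)
  have hv1 : ‖v‖ ≤ 1 := le_of_tendsto hxlim.norm (Eventually.of_forall fun k => (hx1 _).le)
  refine ⟨v, le_antisymm hv1 ?_, hXv⟩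
  have := X.le_opNorm v
  rw [hXv] at this
  exact le_of_mul_le_mul_left (by linarith) hpos

/-- A pair of leading singular vectors. -/
theorem exists_singular_pair {X : S₁ →L[ℝ] S₂} (hX : IsCompactOperator X) :
    ∃ p : S₂ × S₁, X p.2 = ‖X‖ • p.1 ∧ X.adjoint p.1 = ‖X‖ • p.2 ∧
      (X ≠ 0 → ‖p.1‖ = 1 ∧ ‖p.2‖ = 1) := by
  by_cases h0 : X = 0
  -- The zero pair lets the deflation below continue after the residual vanishes.
  · exact ⟨0, by simp [h0]⟩
  obtain ⟨v, hv, hXv⟩ := exists_norm_apply_eq_opNorm hX h0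
  have hpos : 0 < ‖X‖ := norm_pos_iff.2 h0
  have hA : X.adjoint (X v) = ‖X‖ ^ 2 • v := by
    have h := norm_sq_adjoint_apply_sub_le X hv.le
    rw [hXv, sub_self, mul_zero] at h
    exact sub_eq_zero.1 (norm_eq_zero.1 (pow_eq_zero_iff two_ne_zero |>.1
      (le_antisymm h (sq_nonneg _))))
  refine ⟨(‖X‖⁻¹ • X v, v), ?_, ?_, fun _ => ⟨?_, hv⟩⟩
  · simp [smul_smul, hpos.ne']
  · rw [map_smul, hA, smul_smul]
    congr 1
    field_simp
  · simp [norm_smul, hXv, hpos.ne']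

/-- The sequence of residuals obtained by successively splitting off leading singular pairs. -/
def residual (X : {X : S₁ →L[ℝ] S₂ // IsCompactOperator X}) :
    ℕ → {X : S₁ →L[ℝ] S₂ // IsCompactOperator X}
  | 0 => X
  | k + 1 =>
    let Y := residual X k
    let p := (exists_singular_pair Y.2).choose
    ⟨Y.1 - ‖Y.1‖ • rankOne ℝ p.1 p.2,
      Y.2.sub ((isCompactOperator_rankOne p.1 p.2).smul ‖Y.1‖)⟩

/-- Deflation: repeatedly subtract the leading singular term. Vectors already split off lie in the
kernels of all later residuals and of their adjoints, which forces orthogonality; compactness forces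
the residual norms to zero. -/
theorem nonempty_svd_of_isCompactOperator {X : S₁ →L[ℝ] S₂} (hX : IsCompactOperator X) :
    Nonempty (SVD X) := by
  set R : ℕ → (S₁ →L[ℝ] S₂) := fun k => (residual ⟨X, hX⟩ k).1 with hR
  set u : ℕ → S₂ := fun k => (exists_singular_pair (residual ⟨X, hX⟩ k).2).choose.1
  set v : ℕ → S₁ := fun k => (exists_singular_pair (residual ⟨X, hX⟩ k).2).choose.2
  have hspec : ∀ k, R k (v k) = ‖R k‖ • u k ∧ (R k).adjoint (u k) = ‖R k‖ • v k ∧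
      (R k ≠ 0 → ‖u k‖ = 1 ∧ ‖v k‖ = 1) := fun k =>
    (exists_singular_pair (residual ⟨X, hX⟩ k).2).choose_spec
  have hsucc : ∀ k, R (k + 1) = R k - ‖R k‖ • rankOne ℝ (u k) (v k) := fun k => rfl
  have hzero : R 0 = X := rfl
  clear_value R u v
  have happ : ∀ k x, R (k + 1) x = R k (x - inner ℝ (v k) x • v k) := fun k x => by
    simp [hsucc, (hspec k).1, smul_smul, mul_comm]
  have hadj : ∀ k y, (R (k + 1)).adjoint y = (R k).adjoint (y - inner ℝ (u k) y • u k) :=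
    fun k y => by
      refine ext_inner_right ℝ fun x => ?_
      rw [ContinuousLinearMap.adjoint_inner_left, hsucc, map_sub, map_smul, (hspec k).2.1]
      simp only [sub_apply, smul_apply, rankOne_apply,
        inner_sub_left, inner_sub_right, inner_smul_left, inner_smul_right,
        ContinuousLinearMap.adjoint_inner_left, conj_trivial, real_inner_comm (u k) y]
      ring
  have hker : ∀ k w, R k w = 0 → R (k + 1) w = 0 := fun k w hw => by
    rw [hsucc, sub_apply, hw, smul_apply, rankOne_apply,
      smul_smul, zero_sub, neg_eq_zero]
    have : ‖R k‖ * inner ℝ (v k) w = 0 := by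
      have h := ContinuousLinearMap.adjoint_inner_left (R k) w (u k)
      rwa [(hspec k).2.1, hw, inner_zero_right, inner_smul_left, conj_trivial] at h
    rw [this, zero_smul]
  have hker' : ∀ k w, (R k).adjoint w = 0 → (R (k + 1)).adjoint w = 0 := fun k w hw => by
    rw [hadj, map_sub, hw, map_smul, (hspec k).2.1, smul_smul, zero_sub, neg_eq_zero]
    have : inner ℝ (u k) w * ‖R k‖ = 0 := by
      have h := ContinuousLinearMap.adjoint_inner_left (R k) (v k) w
      rw [(hspec k).1, hw, inner_zero_left, inner_smul_right, real_inner_comm] at h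
      linarith
    rw [this, zero_smul]
  have hself : ∀ k, R (k + 1) (v k) = 0 ∧ (R (k + 1)).adjoint (u k) = 0 := fun k => by
    rw [happ, hadj]
    by_cases h0 : R k = 0
    · simp [h0]
    · obtain ⟨h1, h2⟩ := (hspec k).2.2 h0
      simp [h1, h2]
  have hlt : ∀ j k, j < k → R k (v j) = 0 ∧ (R k).adjoint (u j) = 0 := fun j k hjk => by
    induction k, hjk using Nat.le_induction with
    | base => exact hself j
    | succ k _ ih => exact ⟨hker k _ ih.1, hker' k _ ih.2⟩
  have hanti : Antitone fun k => ‖R k‖ := antitone_nat_of_succ_le fun k => by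
    refine ContinuousLinearMap.opNorm_le_bound _ (norm_nonneg _) fun x => ?_
    rw [happ]
    by_cases h0 : R k = 0
    · simp [h0]
    · refine (ContinuousLinearMap.le_opNorm _ _).trans ?_
      gcongr
      obtain ⟨-, h2⟩ := (hspec k).2.2 h0
      refine (sq_le_sq₀ (norm_nonneg _) (norm_nonneg _)).1 ?_
      rw [norm_sub_sq_real, norm_smul, h2, inner_smul_right, real_inner_comm, mul_one,
        Real.norm_eq_abs, sq_abs]
      nlinarith [sq_nonneg (inner ℝ (v k) x)]
  have hne : ∀ k : Function.support fun k => ‖R k‖, R k ≠ 0 := fun k h => k.2 (by simp [h])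
  -- Move `R k` across the inner product: it sends `v k` to a nonzero multiple of `u k` (and its
  -- adjoint does the reverse), but kills the earlier vectors.
  have hortho : ∀ j k, j < k → R k ≠ 0 → inner ℝ (v j) (v k) = 0 ∧ inner ℝ (u j) (u k) = 0 :=
    fun j k hjk h0 => by
      have hn : ‖R k‖ ≠ 0 := norm_ne_zero_iff.2 h0
      have h1 := ContinuousLinearMap.adjoint_inner_left (R k) (v j) (u k)
      have h2 := ContinuousLinearMap.adjoint_inner_left (R k) (v k) (u j)
      rw [(hspec k).2.1, (hlt j k hjk).1, inner_zero_right, inner_smul_left, conj_trivial] at h1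
      rw [(hspec k).1, (hlt j k hjk).2, inner_zero_left, inner_smul_right] at h2
      refine ⟨?_, ?_⟩
      · rw [real_inner_comm]
        exact (mul_eq_zero.1 h1).resolve_left hn
      · exact (mul_eq_zero.1 h2.symm).resolve_left hn
  have hu : Orthonormal ℝ fun k : Function.support fun k => ‖R k‖ => u k := by
    refine ⟨fun k => ((hspec k).2.2 (hne k)).1, fun j k hjk => ?_⟩
    rcases lt_or_gt_of_ne (Subtype.coe_ne_coe.2 hjk) with h | h
    · exact (hortho _ _ h (hne k)).2
    · rw [real_inner_comm]
      exact (hortho _ _ h (hne j)).2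
  have hv : Orthonormal ℝ fun k : Function.support fun k => ‖R k‖ => v k := by
    refine ⟨fun k => ((hspec k).2.2 (hne k)).2, fun j k hjk => ?_⟩
    rcases lt_or_gt_of_ne (Subtype.coe_ne_coe.2 hjk) with h | h
    · exact (hortho _ _ h (hne k)).1
    · rw [real_inner_comm]
      exact (hortho _ _ h (hne j)).1
  have hsum : ∀ N, X = R N + ∑ k ∈ Finset.range N, ‖R k‖ • rankOne ℝ (u k) (v k) := fun N => by
    induction N with
    | zero => simp [hzero]
    | succ N ih =>
      rw [Finset.sum_range_succ, hsucc, ih]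
      abel
  have hXv : ∀ k, R k ≠ 0 → X (v k) = ‖R k‖ • u k := fun k h0 => by
    rw [hsum k, add_apply, (hspec k).1, add_eq_left,
      sum_apply]
    refine Finset.sum_eq_zero fun j hj => ?_
    simp [(hortho j k (Finset.mem_range.1 hj) h0).1]
  -- Otherwise the `X (v k)` are pairwise orthogonal of norm at least `ε`, hence more than `ε`
  -- apart, and have no Cauchy subsequence.
  have hsmall : ∀ ε > 0, ∃ N, ‖R N‖ < ε := by
    intro ε hε
    by_contra! hbig
    have h0 : ∀ k, R k ≠ 0 := fun k h => by
      have := hbig k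
      rw [h, norm_zero] at this
      linarith
    obtain ⟨K, hK, hKX⟩ := hX.image_closedBall_subset_compact (f := X.toLinearMap) 1
    obtain ⟨y, -, φ, hφ, hy⟩ := hK.tendsto_subseq (x := fun k => X (v k)) fun k =>
      hKX ⟨v k, by simpa using ((hspec k).2.2 (h0 k)).2.le, rfl⟩
    obtain ⟨N, hN⟩ := Metric.cauchySeq_iff'.1 hy.cauchySeq ε hε
    have hd := hN (N + 1) (Nat.le_succ N)
    simp only [Function.comp_apply, dist_eq_norm, hXv _ (h0 _)] at hd
    have hlt' : φ N < φ (N + 1) := hφ (Nat.lt_succ_self N)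
    have hsq : ‖‖R (φ (N + 1))‖ • u (φ (N + 1)) - ‖R (φ N)‖ • u (φ N)‖ ^ 2 =
        ‖R (φ (N + 1))‖ ^ 2 + ‖R (φ N)‖ ^ 2 := by
      rw [norm_sub_sq_real, inner_smul_left, inner_smul_right, real_inner_comm,
        (hortho _ _ hlt' (h0 _)).2, norm_smul, norm_smul, ((hspec _).2.2 (h0 _)).1,
        ((hspec _).2.2 (h0 _)).1]
      simp
    have h1 := pow_lt_pow_left₀ hd (norm_nonneg _) two_ne_zero
    have h2 := pow_le_pow_left₀ hε.le (hbig (φ N)) 2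
    nlinarith [sq_nonneg ‖R (φ (N + 1))‖]
  refine ⟨⟨fun k => ‖R k‖, u, v, fun k => norm_nonneg _, hanti, hu, hv, ?_⟩⟩
  rw [HasSum, SummationFilter.unconditional_filter, Metric.tendsto_atTop]
  intro ε hε
  obtain ⟨N, hN⟩ := hsmall (ε / 2) (half_pos hε)
  refine ⟨Finset.range N, fun F hF => ?_⟩
  have hsplit : ∑ k ∈ F, ‖R k‖ • rankOne ℝ (u k) (v k) - X =
      ∑ k ∈ F \ Finset.range N, ‖R k‖ • rankOne ℝ (u k) (v k) - R N := by
    rw [← Finset.sum_sdiff hF]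
    nth_rewrite 1 [hsum N]
    abel
  rw [dist_eq_norm, hsplit]
  -- Any finite set of terms beyond `N` has operator norm at most its largest coefficient, hence at
  -- most `‖R N‖`; this gives unconditional convergence.
  have hB := norm_sum_rankOne_le_of_orthonormal_on hu hv (c := fun k => ‖R k‖)
    (fun k hk => Function.notMem_support.1 hk) (norm_nonneg (R N)) (F \ Finset.range N)
    (fun k hk => by
      rw [abs_norm]
      exact hanti (by simpa using (Finset.mem_sdiff.1 hk).2))
  refine (norm_sub_le _ _).trans_lt ?_
  linarith

end SingularValues

universe w₀ w₁

/-! ### Matricization for a single splitting -/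

section SingleSplitting

variable {ι : Type w₀} [DecidableEq ι] [Fintype ι] {H : ι → Type w₁}
  [∀ i, NormedAddCommGroup (H i)] [∀ i, InnerProductSpace ℝ (H i)] {n : Finset ι}

theorem inner_merge (a a' : HilbertTensor (InFam H n)) (b b' : HilbertTensor (OutFam H n)) :
    inner ℝ (merge H n a b) (merge H n a' b') = inner ℝ a a' * inner ℝ b b' := by
  induction a, a' using UniformSpace.Completion.induction_on₂ with
  | hp => exact isClosed_eq (by fun_prop) (by fun_prop)
  | ih a a' =>
  induction b, b' using UniformSpace.Completion.induction_on₂ with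
  | hp => exact isClosed_eq (by fun_prop) (by fun_prop)
  | ih b b' => simp only [merge_coe, UniformSpace.Completion.inner_coe, inner_algMerge]

theorem norm_merge (a : HilbertTensor (InFam H n)) (b : HilbertTensor (OutFam H n)) :
    ‖merge H n a b‖ = ‖a‖ * ‖b‖ := by
  have h : ‖merge H n a b‖ ^ 2 = (‖a‖ * ‖b‖) ^ 2 := by
    rw [mul_pow, ← real_inner_self_eq_norm_sq, ← real_inner_self_eq_norm_sq,
      ← real_inner_self_eq_norm_sq, inner_merge]
  exact (pow_left_inj₀ (norm_nonneg _) (by positivity) two_ne_zero).1 h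

theorem matricization_merge (a : HilbertTensor (InFam H n)) (b : HilbertTensor (OutFam H n)) :
    matricization n (merge H n a b) = rankOne ℝ a b := by
  ext1 b'
  refine ext_inner_right ℝ fun a' => ?_
  rw [inner_matricization, inner_merge, rankOne_apply, inner_smul_left, conj_trivial, mul_comm]

theorem norm_matricization_le (u : HilbertTensor H) : ‖matricization n u‖ ≤ ‖u‖ := by
  refine ContinuousLinearMap.opNorm_le_bound _ (norm_nonneg _) fun b => ?_
  by_cases h0 : matricization n u b = 0
  · rw [h0, norm_zero]
    positivity
  -- Test the defining identity with `a = matricization n u b`.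
  refine le_of_mul_le_mul_right ?_ (norm_pos_iff.2 h0)
  rw [← real_inner_self_eq_norm_mul_norm, inner_matricization]
  refine (real_inner_le_norm _ _).trans_eq ?_
  rw [norm_merge]
  ring

variable (H n) in
/-- The matricization as a bounded linear map of the tensor. -/
def matricizationL : HilbertTensor H →L[ℝ]
    HilbertTensor (OutFam H n) →L[ℝ] HilbertTensor (InFam H n) :=
  LinearMap.mkContinuous
    { toFun := fun u : HilbertTensor H => matricization n u
      map_add' := fun u u' => by
        ext1 b
        refine ext_inner_right ℝ fun a => ?_
        simp only [add_apply, inner_add_left, inner_matricization]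
      map_smul' := fun c u => by
        ext1 b
        refine ext_inner_right ℝ fun a => ?_
        simp only [smul_apply, inner_smul_left, inner_matricization,
          RingHom.id_apply] }
    1 (fun u => by simpa using norm_matricization_le u)

@[simp]
theorem matricizationL_apply (u : HilbertTensor H) : matricizationL H n u = matricization n u :=
  rfl

/-- Elementary tensors give rank-one operators; linearity, density and closedness of the compact
operators in operator norm do the rest. -/
theorem isCompactOperator_matricization (u : HilbertTensor H) :
    IsCompactOperator (matricization n u) := by
  induction u using UniformSpace.Completion.induction_on with
  | hp => exact isClosed_setOfPred_isCompactOperator.preimage (matricizationL H n).continuous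
  | ih a =>
    rw [← matricizationL_apply]
    induction a using AlgTensor.induction with
    | smul c z =>
      have hm : mergeFam (H := H) (n := n) (fun i => z i.1) (fun i => z i.1) = z := by
        ext i
        simp [mergeFam]
      have hz : matricizationL H n (pure z) = rankOne ℝ (pure fun i : {i // i ∈ n} => z i.1)
          (pure fun i : {i // i ∉ n} => z i.1) := by
        rw [← matricization_merge, merge_pure, hm, matricizationL_apply]
      rw [UniformSpace.Completion.coe_smul, map_smul]
      change IsCompactOperator (c • matricizationL H n (pure z))
      rw [hz]
      exact (isCompactOperator_rankOne _ _).smul c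
    | add a b ha hb =>
      rw [UniformSpace.Completion.coe_add, map_add]
      exact ha.add hb

theorem tensorization_matricization (u : HilbertTensor H) :
    tensorization H n (matricization n u) = u :=
  Function.leftInverse_invFun matricization_injective u

/-! ### Soft thresholding as a proximal map -/

theorem softThreshold_of_nonneg (α : ℝ) {x : ℝ} (hx : 0 ≤ x) (hα : 0 ≤ α) :
    softThreshold α x = max (x - α) 0 := by
  rcases hx.eq_or_lt with rfl | hx
  · simp [softThreshold, hα]
  · rw [softThreshold, Real.sign_of_pos hx, abs_of_pos hx, one_mul]

/-- The soft thresholding of `u` is a finite sum `p = ∑ sₖ (aₖ ⊗ bₖ)` with nonnegative `sₖ` and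
unit vectors such that `u - p` is `α` times a subgradient of the nuclear norm at `p`. -/
theorem exists_matSoftThreshold_eq_sum {α : ℝ} (hα : 0 < α) (u : HilbertTensor H) :
    ∃ (F : Finset ℕ) (s : ℕ → ℝ) (a : ℕ → HilbertTensor (InFam H n))
      (b : ℕ → HilbertTensor (OutFam H n)),
      matSoftThreshold n α u = ∑ k ∈ F, s k • merge H n (a k) (b k) ∧
      (∀ k, 0 ≤ s k) ∧ (∀ k ∈ F, ‖a k‖ = 1 ∧ ‖b k‖ = 1) ∧
      inner ℝ (u - matSoftThreshold n α u) (matSoftThreshold n α u) = α * ∑ k ∈ F, s k ∧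
      ‖matricization n (u - matSoftThreshold n α u)‖ ≤ α := by
  have hne : Nonempty (SVD (matricization n u)) :=
    nonempty_svd_of_isCompactOperator (isCompactOperator_matricization u)
  set S := hne.some with hS
  set s : ℕ → ℝ := fun k => max (S.σ k - α) 0 with hs
  have hsσ : ∀ k, softThreshold α (S.σ k) = s k := fun k =>
    softThreshold_of_nonneg α (S.nonneg k) hα.le
  have hnorm : ∀ k, S.σ k ≠ 0 → ‖S.u k‖ = 1 ∧ ‖S.v k‖ = 1 := fun k hk =>
    ⟨S.orthonormal_u.1 ⟨k, hk⟩, S.orthonormal_v.1 ⟨k, hk⟩⟩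
  -- The terms of the convergent series have norm `S.σ k`, so only finitely many singular values
  -- reach `α`.
  have hσlim : Tendsto S.σ cofinite (𝓝 0) := by
    refine S.hasSum.summable.tendsto_cofinite_zero.norm.congr (fun k => ?_) |>.trans_eq ?_
    · rw [norm_smul, norm_rankOne, Real.norm_of_nonneg (S.nonneg k)]
      by_cases hk : S.σ k = 0
      · simp [hk]
      · simp [hnorm k hk]
    · simp
  have hfin : {k | ¬ S.σ k < α}.Finite := hσlim.eventually (gt_mem_nhds hα)
  set F : Finset ℕ := hfin.toFinset with hF
  have hFmem : ∀ k, k ∈ F ↔ α ≤ S.σ k := fun k => by simp [hF]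
  have hFs : ∀ k ∈ F, s k = S.σ k - α := fun k hk =>
    max_eq_left (sub_nonneg.2 ((hFmem k).1 hk))
  have hFs' : ∀ k ∉ F, s k = 0 := fun k hk =>
    max_eq_right (sub_nonpos.2 (not_le.1 fun h => hk ((hFmem k).2 h)).le)
  have hFσ : ∀ k ∈ F, S.σ k ≠ 0 := fun k hk => (hα.trans_le ((hFmem k).1 hk)).ne'
  set p : HilbertTensor H := ∑ k ∈ F, s k • merge H n (S.u k) (S.v k) with hp
  have hMp : matricization n p = ∑ k ∈ F, s k • rankOne ℝ (S.u k) (S.v k) := by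
    rw [← matricizationL_apply, hp, map_sum]
    refine Finset.sum_congr rfl fun k _ => ?_
    rw [map_smul, matricizationL_apply, matricization_merge]
  -- The thresholded series is a finite sum, visibly the matricization of `p`, so the `invFun` in
  -- `tensorization` returns `p`.
  have hpeq : matSoftThreshold n α u = p := by
    rw [matSoftThreshold, softThresholdOp, dif_pos hne, ← hS]
    simp only [hsσ]
    rw [tsum_eq_sum (s := F) (fun k hk => by rw [hFs' k hk, zero_smul]), ← hMp,
      tensorization_matricization]
  have hMg : HasSum (fun k => (S.σ k - s k) • rankOne ℝ (S.u k) (S.v k))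
      (matricization n (u - p)) := by
    have h := S.hasSum.sub (hasSum_sum_of_ne_finset_zero (s := F)
      (f := fun k => s k • rankOne ℝ (S.u k) (S.v k))
      (fun k hk => by rw [hFs' k hk, zero_smul]))
    have hsub : matricization n (u - p) = matricization n u - matricization n p :=
      map_sub (matricizationL H n) u p
    rw [hsub, hMp]
    simpa only [sub_smul] using h
  have hs0 : ∀ k, 0 ≤ s k := fun k => le_max_right _ _
  refine ⟨F, s, S.u, S.v, hpeq, hs0, fun k hk => hnorm k (hFσ k hk), ?_, ?_⟩
  · rw [hpeq]
    nth_rewrite 2 [hp]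
    rw [inner_sum, Finset.mul_sum]
    refine Finset.sum_congr rfl fun k hk => ?_
    rw [inner_smul_right, ← inner_matricization, mul_comm]
    congr 1
    obtain ⟨h1, h2⟩ := hnorm k (hFσ k hk)
    -- Evaluating the series of `u - p` at `S.v k` and pairing with `S.u k` isolates the coefficient
    -- `S.σ k - s k`, which is `α` on `F`.
    have hv := hMg.mapL (ContinuousLinearMap.apply ℝ (HilbertTensor (InFam H n)) (S.v k))
    have huv := hv.mapL (innerSL ℝ (S.u k))
    simp only [ContinuousLinearMap.apply_apply, smul_apply, rankOne_apply,
      innerSL_apply_apply, inner_smul_right] at huv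
    rw [real_inner_comm]
    refine huv.unique ?_
    have hone := hasSum_single (f := fun j => (S.σ j - s j) *
      (inner ℝ (S.v j) (S.v k) * inner ℝ (S.u k) (S.u j))) k (fun j hj => by
        by_cases hσj : S.σ j = 0
        · have : s j = 0 := hFs' j fun h => hFσ j h hσj
          simp [this, hσj]
        · have := S.orthonormal_v.2 (i := ⟨j, hσj⟩) (j := ⟨k, hFσ k hk⟩)
            (fun h => hj (congrArg Subtype.val h))
          simp only at this
          rw [this]
          ring)
    simpa [real_inner_self_eq_norm_sq, h1, h2, hFs k hk] using hone
  · rw [hpeq]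
    refine le_of_tendsto hMg.norm (Eventually.of_forall fun G => ?_)
    refine norm_sum_rankOne_le_of_orthonormal_on S.orthonormal_u S.orthonormal_v
      (fun k hk => ?_) hα.le G (fun k _ => ?_)
    · have hk0 : S.σ k = 0 := Function.notMem_support.1 hk
      rw [hk0, hFs' k fun h => hFσ k h hk0, sub_zero]
    -- The coefficient `S.σ k - s k` is `min (S.σ k) α`.
    · rw [abs_of_nonneg]
      · linarith [le_max_left (S.σ k - α) 0]
      · exact sub_nonneg.2 (max_le (by linarith) (S.nonneg k))

theorem norm_matSoftThreshold_sub_le {α : ℝ} (hα : 0 < α) (u v : HilbertTensor H) :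
    ‖matSoftThreshold n α u - matSoftThreshold n α v‖ ≤ ‖u - v‖ := by
  have key : ∀ u v : HilbertTensor H,
      inner ℝ (u - matSoftThreshold n α u) (matSoftThreshold n α v) ≤
        inner ℝ (v - matSoftThreshold n α v) (matSoftThreshold n α v) := fun u v => by
    obtain ⟨_, _, _, _, -, -, -, -, hg⟩ := exists_matSoftThreshold_eq_sum (n := n) hα u
    obtain ⟨F, s, a, b, hp, hs, hab, hin, -⟩ := exists_matSoftThreshold_eq_sum (n := n) hα v
    rw [hin, hp, inner_sum, Finset.mul_sum]
    refine Finset.sum_le_sum fun k hk => ?_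
    obtain ⟨ha, hb⟩ := hab k hk
    -- Termwise duality: a unit elementary pair tests the matricization of `u - p`, whose operator
    -- norm is at most `α`.
    rw [inner_smul_right, ← inner_matricization, mul_comm]
    refine mul_le_mul_of_nonneg_right ?_ (hs k)
    refine (real_inner_le_norm _ _).trans ?_
    rw [ha, mul_one]
    exact (ContinuousLinearMap.unit_le_opNorm _ _ hb.le).trans hg
  set p := matSoftThreshold n α u
  set q := matSoftThreshold n α v
  have h1 := key u v
  have h2 := key v u
  -- Firm nonexpansiveness, the sum of `h1` and `h2`.
  have hmono : ‖p - q‖ * ‖p - q‖ ≤ inner ℝ (u - v) (p - q) := by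
    rw [← real_inner_self_eq_norm_mul_norm]
    simp only [inner_sub_left, inner_sub_right] at h1 h2 ⊢
    linarith
  rcases (norm_nonneg (p - q)).eq_or_lt with h0 | hpos
  · rw [← h0]
    exact norm_nonneg _
  · exact le_of_mul_le_mul_right (hmono.trans (real_inner_le_norm _ _)) hpos

theorem norm_hierSoftThreshold_sub_le {α : ℝ} (hα : 0 < α) {E : ℕ} (n : Fin E → Finset ι)
    (u v : HilbertTensor H) :
    ‖hierSoftThreshold n α u - hierSoftThreshold n α v‖ ≤ ‖u - v‖ := by
  induction E with
  | zero => simp [hierSoftThreshold]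
  | succ E ih =>
    -- Peels off the outermost thresholding, the one applied last.
    simp only [hierSoftThreshold, Fin.foldl_succ_last]
    exact (norm_matSoftThreshold_sub_le hα _ _).trans (ih fun t => n t.castSucc)

end SingleSplitting

end HTensor

end

theorem proposition3p1 {d : ℕ} (hd : 2 ≤ d) (H : Fin d → Type*)
    [∀ i, NormedAddCommGroup (H i)] [∀ i, InnerProductSpace ℝ (H i)]
    [∀ i, CompleteSpace (H i)] [∀ i, TopologicalSpace.SeparableSpace (H i)]
    (T : Finset (Finset (Fin d))) (hT : HTensor.IsDimTree Finset.univ T)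
    (n : Fin (2 * d - 3) → Finset (Fin d)) (hn : HTensor.IsEdgeEnumeration T n)
    (α : ℝ) (hα : 0 < α) (u v : HTensor.HilbertTensor H) :
    ‖HTensor.hierSoftThreshold n α u - HTensor.hierSoftThreshold n α v‖ ≤ ‖u - v‖ :=
  HTensor.norm_hierSoftThreshold_sub_le hα n u v
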